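/- Fix integers $r,g\ge 0$. A \emph{bipartite colored modular graph} $\Gamma$ (with colors $1,\dots,r$) is a finite graph, loops and multiple edges being a priori allowed, which may also have tails (edges with only one end), together with the following data. Its vertex set is a disjoint union $V_a(\Gamma)\sqcup V_s(\Gamma)$; every edge joins an $a$-vertex to an $s$-vertex; every $s$-vertex is incident to exactly two edges and to no tails; every edge and every tail is colored by an element of $\{1,\dots,r\}$; and every $v\in V_a(\Gamma)$ has a genus $g(v)\in\{0,1,2,\dots\}$. The genus of $\Gamma$ is $g(\Gamma)=\sum_{v\in V_a(\Gamma)}g(v)+b_1(\Gamma)-b_0(\Gamma)+1$, where $b_0,b_1$ are the Betti numbers of the graph. The valence of $v\in V_a(\Gamma)$ is the multi-index $N(v)=(\nu_1(v),\dots,\nu_r(v))$, where $\nu_i(v)$ is the number of edges and tails of color $i$ at $v$; put $|N|=\sum_i n_i$ for $N=(n_1,\dots,n_r)$. The graph is \emph{closed} if it has no tails, and \emph{stable} if $|N(v)|\ge 3$ for every $a$-vertex with $g(v)=0$ and $|N(v)|\ge 1$ for every $a$-vertex with $g(v)=1$. Let $a_{m,N}$ ($m\ge0$, $N\in\mathbb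 Z_{\ge0}^r$) and $s_{ij}=s_{ji}$ ($1\le i,j\le r$) be independent commuting variables, and put $$\mu(\Gamma)=\prod_{v\in V_a(\Gamma)}a_{g(v),N(v)}\prod_{v\in V_s(\Gamma)}s_{i(v)j(v)},$$ where $i(v),j(v)$ are the colors of the two edges at the $s$-vertex $v$. Then there are only finitely many isomorphism classes of connected stable closed bipartite colored modular graphs of genus $g$, so that the \emph{stable graph polynomial} $$P_g(\{a_{m,N}\},S)=\sum_{\Gamma}\frac{\mu(\Gamma)}{|\mathrm{Aut}\,\Gamma|}\in\mathbb C[\{s_{ij}\},\{a_{m,N}\}],$$ the sum being over these classes, is a well-defined polynomial. Here isomorphisms and automorphisms act on vertices, edges and tails (including multiple edges) and preserve the two kinds of vertices, the colors and the genera. Moreover, for the $\mathbb Z$-grading of $\mathbb C[\{s_{ij}\},\{a_{m,N}\}]$ defined by $$\deg a_{m,N}=1-|N|-m,\qquad \deg s_{ij}=1,$$ the polynomial $P_g$ is homogeneous of degree $1-g$. -/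

import Mathlib

noncomputable section

namespace StableGraph

/-- A (finite) modular graph with vertex set `V` and set of flags (half-edges) `F`: every flag is
attached to a vertex, and an involution on the flags glues them together.  The two-element orbits
of the involution are the edges, its fixed points are the tails.  Loops and multiple edges are
allowed. -/
structure ModularGraph (V F : Type) where
  root : F → V
  inv : F → F
  inv_inv : ∀ f, inv (inv f) = f

namespace ModularGraph

variable {V F : Type} (G : ModularGraph V F)

/-- The flag `f` is a tail, i.e. an edge with only one end. -/
def IsTail (f : F) : Prop := G.inv f = f

/-- The simple graph on the vertices in which two distinct vertices are adjacent when
some edge joins them. -/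
def toSimpleGraph : SimpleGraph V :=
  SimpleGraph.fromRel fun u v => ∃ f : F, G.root f = u ∧ G.root (G.inv f) = v

/-- Connectedness (a connected graph has at least one vertex). -/
def IsConnected : Prop := G.toSimpleGraph.Connected

/-- Rational `1`-chains: antisymmetric functions on flags.  The edge `{f, f'}`, oriented from `f'`
to `f`, is the chain `δ_f - δ_f'`; tails do not contribute, a `1`-chain vanishes on them. -/
def oneChains : Submodule ℚ (F → ℚ) where
  carrier := {c | ∀ f, c (G.inv f) = - c f}
  add_mem' := by
    intro c d hc hd f
    simp only [Pi.add_apply, hc f, hd f]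
    ring
  zero_mem' := by intro f; simp
  smul_mem' := by
    intro t c hc f
    simp only [Pi.smul_apply, hc f, smul_neg]

open Classical in
/-- The boundary map from `1`-chains to `0`-chains (rational functions on vertices):
`δ_f - δ_f'` is sent to `δ_(root f) - δ_(root f')`. -/
def boundary [Fintype F] : G.oneChains →ₗ[ℚ] (V → ℚ) where
  toFun c := fun v => ∑ f : F, if G.root f = v then (c : F → ℚ) f else 0
  map_add' := by
    intro c d
    funext v
    simp only [Submodule.coe_add, Pi.add_apply]
    rw [← Finset.sum_add_distrib]
    refine Finset.sum_congr rfl fun f _ => ?_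
    split_ifs <;> simp
  map_smul' := by
    intro t c
    funext v
    simp [Finset.mul_sum]

/-- The zeroth Betti number: the dimension of `H₀`, the cokernel of the boundary map. -/
def betti0 [Fintype F] : ℕ := Module.finrank ℚ ((V → ℚ) ⧸ LinearMap.range G.boundary)

/-- The first Betti number: the dimension of `H₁`, the kernel of the boundary map. -/
def betti1 [Fintype F] : ℕ := Module.finrank ℚ (LinearMap.ker G.boundary)

end ModularGraph

/-- A finite bipartite colored modular graph with colors `1, …, r`: the vertices are divided into
`a`-vertices (carrying a genus) and `s`-vertices, all edges and tails are colored, every edge joins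
an `a`-vertex to an `s`-vertex, and every `s`-vertex is two-valent and has no tails. -/
structure BipartiteColoredGraph (r : ℕ) where
  VA : Type
  VS : Type
  Flag : Type
  [fintypeVA : Fintype VA]
  [fintypeVS : Fintype VS]
  [fintypeFlag : Fintype Flag]
  graph : ModularGraph (VA ⊕ VS) Flag
  /-- the color of the edge or tail to which the flag belongs -/
  color : Flag → Fin r
  color_inv : ∀ f, color (graph.inv f) = color f
  genus : VA → ℕ
  bipartite : ∀ f, ¬ graph.IsTail f →
    ((graph.root f).isLeft ↔ (graph.root (graph.inv f)).isRight)
  two_valent : ∀ v : VS, Nat.card {f : Flag // graph.root f = Sum.inr v} = 2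
  no_tail : ∀ f, (graph.root f).isRight → ¬ graph.IsTail f

attribute [instance] BipartiteColoredGraph.fintypeVA BipartiteColoredGraph.fintypeVS
  BipartiteColoredGraph.fintypeFlag

/-- The variables: `a m N` is `a_{m,N}` (`N` a multi-index) and `s s(i, j)` is the entry
`s_{ij} = s_{ji}` of the symmetric matrix `S`. -/
inductive Var (r : ℕ) : Type
  | a (m : ℕ) (N : Fin r → ℕ) : Var r
  | s (e : Sym2 (Fin r)) : Var r

/-- The grading: `deg a_{m,N} = 1 - |N| - m` and `deg s_{ij} = 1`. -/
def degree (r : ℕ) : Var r → ℤ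
  | Var.a m N => 1 - ((∑ i, N i : ℕ) : ℤ) - (m : ℤ)
  | Var.s _ => 1

namespace BipartiteColoredGraph

variable {r : ℕ}

/-- The genus of a graph: the sum of the genera of its `a`-vertices, plus `b₁ - b₀ + 1`. -/
def totalGenus (Γ : BipartiteColoredGraph r) : ℤ :=
  ((∑ v, Γ.genus v : ℕ) : ℤ) + (Γ.graph.betti1 : ℤ) - (Γ.graph.betti0 : ℤ) + 1

/-- A closed graph has no tails. -/
def IsClosed (Γ : BipartiteColoredGraph r) : Prop := ∀ f, ¬ Γ.graph.IsTail f

/-- The valence of an `a`-vertex: the multi-index whose `i`-th entry is the number of edges and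
tails of color `i` at that vertex.  (No edge can be attached twice to one vertex, so these are
counted by flags.) -/
def valence (Γ : BipartiteColoredGraph r) (v : Γ.VA) : Fin r → ℕ := fun i =>
  Nat.card {f : Γ.Flag // Γ.graph.root f = Sum.inl v ∧ Γ.color f = i}

/-- Stability: `a`-vertices of genus zero are at least trivalent and `a`-vertices of genus one
are at least univalent. -/
def IsStable (Γ : BipartiteColoredGraph r) : Prop :=
  ∀ v : Γ.VA, (Γ.genus v = 0 → 3 ≤ ∑ i, Γ.valence v i) ∧
    (Γ.genus v = 1 → 1 ≤ ∑ i, Γ.valence v i)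

open Classical in
/-- The multiset of the colors of the two edges at an `s`-vertex. -/
def colors (Γ : BipartiteColoredGraph r) (v : Γ.VS) : Multiset (Fin r) :=
  (Finset.univ : Finset {f : Γ.Flag // Γ.graph.root f = Sum.inr v}).val.map
    fun f => Γ.color f.1

theorem card_colors (Γ : BipartiteColoredGraph r) (v : Γ.VS) :
    Multiset.card (Γ.colors v) = 2 := by
  classical
  have h := Γ.two_valent v
  rw [Nat.card_eq_fintype_card] at h
  rw [colors, Multiset.card_map, ← h, ← Finset.card_univ, Finset.card_def]

/-- The unordered pair of the colors of the two edges at an `s`-vertex. -/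
def colorPair (Γ : BipartiteColoredGraph r) (v : Γ.VS) : Sym2 (Fin r) :=
  (Sym2.equivSym (Fin r)).symm ⟨Γ.colors v, Γ.card_colors v⟩

/-- The monomial of a graph: the product of `a_{g(v),N(v)}` over the `a`-vertices and of `s_{ij}`
over the `s`-vertices, `i` and `j` being the colors of the two edges at the `s`-vertex. -/
def monomial (Γ : BipartiteColoredGraph r) : MvPolynomial (Var r) ℂ :=
  (∏ v : Γ.VA, MvPolynomial.X (Var.a (Γ.genus v) (Γ.valence v))) *
    ∏ v : Γ.VS, MvPolynomial.X (Var.s (Γ.colorPair v))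

/-- Isomorphisms of bipartite colored modular graphs. -/
@[ext]
structure Iso (Γ Δ : BipartiteColoredGraph r) where
  onVA : Γ.VA ≃ Δ.VA
  onVS : Γ.VS ≃ Δ.VS
  onFlag : Γ.Flag ≃ Δ.Flag
  map_root : ∀ f, Δ.graph.root (onFlag f) = Sum.map onVA onVS (Γ.graph.root f)
  map_inv : ∀ f, Δ.graph.inv (onFlag f) = onFlag (Γ.graph.inv f)
  map_color : ∀ f, Δ.color (onFlag f) = Γ.color f
  map_genus : ∀ v, Δ.genus (onVA v) = Γ.genus v

namespace Iso

variable {Γ Δ Λ : BipartiteColoredGraph r}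

def refl (Γ : BipartiteColoredGraph r) : Iso Γ Γ where
  onVA := Equiv.refl _
  onVS := Equiv.refl _
  onFlag := Equiv.refl _
  map_root f := by simp
  map_inv f := rfl
  map_color f := rfl
  map_genus v := rfl

def symm (e : Iso Γ Δ) : Iso Δ Γ where
  onVA := e.onVA.symm
  onVS := e.onVS.symm
  onFlag := e.onFlag.symm
  map_root f := by
    have h := e.map_root (e.onFlag.symm f)
    rw [Equiv.apply_symm_apply] at h
    rw [h, Sum.map_map]
    simp
  map_inv f := by
    have h := e.map_inv (e.onFlag.symm f)
    rw [Equiv.apply_symm_apply] at h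
    rw [h, Equiv.symm_apply_apply]
  map_color f := by
    have h := e.map_color (e.onFlag.symm f)
    rw [Equiv.apply_symm_apply] at h
    exact h.symm
  map_genus v := by
    have h := e.map_genus (e.onVA.symm v)
    rw [Equiv.apply_symm_apply] at h
    exact h.symm

def trans (e : Iso Γ Δ) (e' : Iso Δ Λ) : Iso Γ Λ where
  onVA := e.onVA.trans e'.onVA
  onVS := e.onVS.trans e'.onVS
  onFlag := e.onFlag.trans e'.onFlag
  map_root f := by
    simp only [Equiv.trans_apply, e'.map_root, e.map_root, Sum.map_map, Equiv.coe_trans]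
  map_inv f := by simp only [Equiv.trans_apply, e'.map_inv, e.map_inv]
  map_color f := by simp only [Equiv.trans_apply, e'.map_color, e.map_color]
  map_genus v := by simp only [Equiv.trans_apply, e'.map_genus, e.map_genus]

theorem root_eq_inl (e : Iso Γ Δ) (v : Γ.VA) (f : Γ.Flag) :
    Δ.graph.root (e.onFlag f) = Sum.inl (e.onVA v) ↔ Γ.graph.root f = Sum.inl v := by
  rw [e.map_root]
  rcases Γ.graph.root f with w | w <;> simp

theorem root_eq_inr (e : Iso Γ Δ) (v : Γ.VS) (f : Γ.Flag) :
    Δ.graph.root (e.onFlag f) = Sum.inr (e.onVS v) ↔ Γ.graph.root f = Sum.inr v := by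
  rw [e.map_root]
  rcases Γ.graph.root f with w | w <;> simp

theorem valence_eq (e : Iso Γ Δ) (v : Γ.VA) : Δ.valence (e.onVA v) = Γ.valence v := by
  funext i
  refine (Nat.card_congr (e.onFlag.subtypeEquiv fun f => ?_)).symm
  rw [e.root_eq_inl, e.map_color]

theorem colors_eq (e : Iso Γ Δ) (v : Γ.VS) : Δ.colors (e.onVS v) = Γ.colors v := by
  classical
  let E : {f : Γ.Flag // Γ.graph.root f = Sum.inr v} ≃
      {f : Δ.Flag // Δ.graph.root f = Sum.inr (e.onVS v)} :=
    e.onFlag.subtypeEquiv fun f => (e.root_eq_inr v f).symm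
  unfold colors
  rw [← Multiset.map_univ_val_equiv E, Multiset.map_map]
  refine Multiset.map_congr rfl fun f _ => ?_
  exact e.map_color f.1

theorem colorPair_eq (e : Iso Γ Δ) (v : Γ.VS) : Δ.colorPair (e.onVS v) = Γ.colorPair v := by
  exact congrArg (Sym2.equivSym (Fin r)).symm (Subtype.ext (e.colors_eq v))

theorem monomial_eq (e : Iso Γ Δ) : Γ.monomial = Δ.monomial := by
  unfold monomial
  congr 1
  · refine Fintype.prod_equiv e.onVA _ _ fun v => ?_
    rw [e.map_genus, e.valence_eq]
  · refine Fintype.prod_equiv e.onVS _ _ fun v => ?_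
    rw [e.colorPair_eq]

end Iso

/-- `|Aut Γ|`, the number of automorphisms of a graph. -/
def cardAut (Γ : BipartiteColoredGraph r) : ℕ := Nat.card (Iso Γ Γ)

theorem Iso.cardAut_eq {Γ Δ : BipartiteColoredGraph r} (e : Iso Γ Δ) :
    Γ.cardAut = Δ.cardAut := by
  refine Nat.card_congr
    { toFun := fun t => (e.symm.trans t).trans e
      invFun := fun t => (e.trans t).trans e.symm
      left_inv := ?_
      right_inv := ?_ }
  · intro t
    ext x <;> simp [Iso.trans, Iso.symm]
  · intro t
    ext x <;> simp [Iso.trans, Iso.symm]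

end BipartiteColoredGraph

/-- The connected stable closed bipartite colored graphs of genus `g`. -/
def StableClosedGraph (r g : ℕ) : Type 1 :=
  {Γ : BipartiteColoredGraph r //
    Γ.graph.IsConnected ∧ Γ.IsClosed ∧ Γ.IsStable ∧ Γ.totalGenus = (g : ℤ)}

instance isoSetoid (r g : ℕ) : Setoid (StableClosedGraph r g) where
  r Γ Δ := Nonempty (BipartiteColoredGraph.Iso Γ.1 Δ.1)
  iseqv :=
    { refl := fun Γ => ⟨BipartiteColoredGraph.Iso.refl Γ.1⟩
      symm := fun ⟨e⟩ => ⟨e.symm⟩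
      trans := fun ⟨e⟩ ⟨e'⟩ => ⟨e.trans e'⟩ }

/-- Isomorphism classes of connected stable closed graphs of genus `g`. -/
def StableClass (r g : ℕ) : Type 1 := Quotient (isoSetoid r g)

/-- The contribution `μ(Γ) / |Aut Γ|` of an isomorphism class of graphs. -/
def StableClass.term {r g : ℕ} (q : StableClass r g) : MvPolynomial (Var r) ℂ :=
  Quotient.lift
    (fun Γ : StableClosedGraph r g => ((Γ.1.cardAut : ℂ)⁻¹) • Γ.1.monomial)
    (by
      rintro Γ Δ ⟨e⟩
      simp only [e.cardAut_eq, e.monomial_eq]) q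

/-- The stable graph polynomial `P_g`: the sum of `μ(Γ) / |Aut Γ|` over the isomorphism classes of
connected stable closed graphs of genus `g`. -/
def stableGraphPolynomial (r g : ℕ) : MvPolynomial (Var r) ℂ :=
  ∑ᶠ q : StableClass r g, q.term

end StableGraph

end

namespace StableGraph

open BipartiteColoredGraph

/-! Everything reduces to Euler characteristics. In a closed bipartite graph each edge has exactly
one end at an `s`-vertex, so there are `2|V_s|` edges, and `b₁ - b₀ = 2|V_s| - (|V_a| + |V_s|)`.
Hence `g(Γ) - 1 = ∑ g(v) + |V_s| - |V_a|` (`IsClosed.totalGenus_eq`). Counting edges at their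
`a`-ends gives `∑ |N(v)| = 2|V_s|` (`IsClosed.sum_valence`), so `deg μ(Γ) = |V_a| - 2|V_s| - ∑ g(v)
+ |V_s| = 1 - g(Γ)`.

For finiteness, stability says `3 ≤ 2 g(v) + |N(v)|`. Summing over `v` bounds the number of
vertices, the number of flags and the genera in terms of `g` (`IsStable.bounds`), and only finitely
many graphs fit within such bounds. -/

/-- `b₁ - b₀ = dim C₁ - dim C₀`. -/
theorem ModularGraph.betti1_sub_betti0 {V F : Type} [Fintype V] [Fintype F]
    (G : ModularGraph V F) :
    (G.betti1 : ℤ) - (G.betti0 : ℤ) = (Module.finrank ℚ G.oneChains : ℤ) - Fintype.card V := by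
  have h1 := LinearMap.finrank_range_add_finrank_ker G.boundary
  have h2 := Submodule.finrank_quotient_add_finrank (LinearMap.range G.boundary)
  rw [Module.finrank_fintype_fun_eq_card] at h2
  unfold ModularGraph.betti1 ModularGraph.betti0
  -- Rank-nullity for the boundary and for its cokernel: the rank of the boundary cancels in the
  -- difference.
  omega

namespace BipartiteColoredGraph

variable {r : ℕ} (Γ : BipartiteColoredGraph r)

/-! ### Counting edges and flags of a closed graph -/

theorem IsClosed.isRight_inv_iff {Γ : BipartiteColoredGraph r} (hc : Γ.IsClosed) (f : Γ.Flag) :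
    (Γ.graph.root (Γ.graph.inv f)).isRight ↔ (Γ.graph.root f).isLeft :=
  (Γ.bipartite f (hc f)).symm

theorem IsClosed.isLeft_inv_iff {Γ : BipartiteColoredGraph r} (hc : Γ.IsClosed) (f : Γ.Flag) :
    (Γ.graph.root (Γ.graph.inv f)).isLeft ↔ (Γ.graph.root f).isRight := by
  have h := Γ.bipartite _ (hc (Γ.graph.inv f))
  rwa [Γ.graph.inv_inv] at h

/-- On a closed bipartite graph a `1`-chain is determined by its values on the flags at the
`s`-vertices, and these are arbitrary. -/
def IsClosed.oneChainsEquiv {Γ : BipartiteColoredGraph r} (hc : Γ.IsClosed) :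
    Γ.graph.oneChains ≃ₗ[ℚ] ({f : Γ.Flag // (Γ.graph.root f).isRight} → ℚ) where
  toFun c f := (c : Γ.Flag → ℚ) f.1
  map_add' _ _ := rfl
  map_smul' _ _ := rfl
  -- The involution swaps the `a`-flags and the `s`-flags, so antisymmetry forces the value on each
  -- `a`-flag.
  invFun d := ⟨fun f => if h : (Γ.graph.root f).isRight then d ⟨f, h⟩
      else - d ⟨Γ.graph.inv f, (hc.isRight_inv_iff f).2 (by simpa using h)⟩, by
    intro f
    by_cases h : (Γ.graph.root f).isRight
    · have h' : ¬ (Γ.graph.root (Γ.graph.inv f)).isRight := by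
        rw [hc.isRight_inv_iff]; simpa using h
      simp only [dif_pos h, dif_neg h', Γ.graph.inv_inv]
    · have h' : (Γ.graph.root (Γ.graph.inv f)).isRight := by
        rw [hc.isRight_inv_iff]; simpa using h
      simp only [dif_neg h, dif_pos h', neg_neg]⟩
  left_inv c := by
    ext f
    by_cases h : (Γ.graph.root f).isRight
    · simp only [dif_pos h]
    · simp only [dif_neg h, c.2 f, neg_neg]
  right_inv d := by
    funext f
    simp only [dif_pos f.2]

/-- The flags at the `s`-vertices, sorted by vertex. -/
def rightFlagEquiv :
    {f : Γ.Flag // (Γ.graph.root f).isRight} ≃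
      Σ v : Γ.VS, {f : Γ.Flag // Γ.graph.root f = Sum.inr v} where
  toFun f := ⟨(Γ.graph.root f.1).getRight f.2, f.1, by simp⟩
  invFun x := ⟨x.2.1, by simp [x.2.2]⟩
  left_inv f := rfl
  right_inv := by
    rintro ⟨v, f, hf⟩
    exact Sigma.subtype_ext (by simp [hf]) rfl

/-- The flags at the `a`-vertices, sorted by vertex and color. -/
def leftFlagEquiv :
    {f : Γ.Flag // (Γ.graph.root f).isLeft} ≃
      Σ p : Γ.VA × Fin r, {f : Γ.Flag // Γ.graph.root f = Sum.inl p.1 ∧ Γ.color f = p.2} where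
  toFun f := ⟨((Γ.graph.root f.1).getLeft f.2, Γ.color f.1), f.1, by simp⟩
  invFun x := ⟨x.2.1, by simp [x.2.2.1]⟩
  left_inv f := rfl
  right_inv := by
    rintro ⟨⟨v, i⟩, f, hf, hi⟩
    exact Sigma.subtype_ext (Prod.ext (by simp [hf]) hi) rfl

theorem card_rightFlag :
    Nat.card {f : Γ.Flag // (Γ.graph.root f).isRight} = 2 * Fintype.card Γ.VS := by
  rw [Nat.card_congr Γ.rightFlagEquiv, Nat.card_sigma]
  simp [Γ.two_valent, mul_comm]

theorem card_leftFlag :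
    Nat.card {f : Γ.Flag // (Γ.graph.root f).isLeft} = ∑ v, ∑ i, Γ.valence v i := by
  rw [Nat.card_congr Γ.leftFlagEquiv, Nat.card_sigma, Fintype.sum_prod_type]
  rfl

variable {Γ}

/-- Without tails, the involution is a bijection between flags at `a`-vertices and flags at
`s`-vertices, and the latter come two per `s`-vertex. -/
theorem IsClosed.sum_valence (hc : Γ.IsClosed) :
    ∑ v, ∑ i, Γ.valence v i = 2 * Fintype.card Γ.VS := by
  rw [← card_leftFlag, ← card_rightFlag]
  refine Nat.card_congr
    { toFun := fun f => ⟨Γ.graph.inv f.1, (hc.isRight_inv_iff f.1).2 f.2⟩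
      invFun := fun f => ⟨Γ.graph.inv f.1, (hc.isLeft_inv_iff f.1).2 f.2⟩
      left_inv := fun f => Subtype.ext (Γ.graph.inv_inv f.1)
      right_inv := fun f => Subtype.ext (Γ.graph.inv_inv f.1) }

theorem IsClosed.card_flag (hc : Γ.IsClosed) :
    Fintype.card Γ.Flag = 4 * Fintype.card Γ.VS := by
  have h := Fintype.card_subtype_compl fun f : Γ.Flag => ((Γ.graph.root f).isRight : Prop)
  have hle := Fintype.card_subtype_le fun f : Γ.Flag => ((Γ.graph.root f).isRight : Prop)
  have h1 := Γ.card_rightFlag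
  have h2 := Γ.card_leftFlag
  rw [hc.sum_valence] at h2
  rw [Nat.card_eq_fintype_card] at h1 h2
  have h3 : Fintype.card {f : Γ.Flag // ¬ ((Γ.graph.root f).isRight : Prop)} =
      Fintype.card {f : Γ.Flag // (Γ.graph.root f).isLeft} :=
    Fintype.card_congr (Equiv.subtypeEquivRight fun f => by simp)
  omega

theorem IsClosed.totalGenus_eq (hc : Γ.IsClosed) :
    Γ.totalGenus = ((∑ v, Γ.genus v : ℕ) : ℤ) + Fintype.card Γ.VS - Fintype.card Γ.VA + 1 := by
  have h1 := Γ.graph.betti1_sub_betti0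
  have h2 := hc.oneChainsEquiv.finrank_eq
  rw [Module.finrank_fintype_fun_eq_card, ← Nat.card_eq_fintype_card, card_rightFlag] at h2
  rw [h2, Fintype.card_sum] at h1
  unfold totalGenus
  push_cast at h1 ⊢
  linarith

/-! ### Degree of the monomial of a graph -/

theorem IsClosed.isWeightedHomogeneous_monomial (hc : Γ.IsClosed) :
    MvPolynomial.IsWeightedHomogeneous (degree r) Γ.monomial (1 - Γ.totalGenus) := by
  have ha := MvPolynomial.IsWeightedHomogeneous.prod (w := degree r) (Finset.univ : Finset Γ.VA)
    (fun v => (MvPolynomial.X (Var.a (Γ.genus v) (Γ.valence v)) : MvPolynomial (Var r) ℂ)) _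
    fun v _ => MvPolynomial.isWeightedHomogeneous_X ℂ (degree r) _
  have hs := MvPolynomial.IsWeightedHomogeneous.prod (w := degree r) (Finset.univ : Finset Γ.VS)
    (fun v => (MvPolynomial.X (Var.s (Γ.colorPair v)) : MvPolynomial (Var r) ℂ)) _
    fun v _ => MvPolynomial.isWeightedHomogeneous_X ℂ (degree r) _
  have h := ha.mul hs
  have hdeg : (∑ v, degree r (Var.a (Γ.genus v) (Γ.valence v))) +
      ∑ v, degree r (Var.s (Γ.colorPair v)) = 1 - Γ.totalGenus := by
    have hv : ((∑ v, ∑ i, Γ.valence v i : ℕ) : ℤ) = 2 * Fintype.card Γ.VS := by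
      rw [hc.sum_valence]; push_cast; rfl
    rw [hc.totalGenus_eq]
    simp only [degree, Finset.sum_sub_distrib, Finset.sum_const, Finset.card_univ, nsmul_eq_mul,
      mul_one]
    push_cast at hv ⊢
    linarith
  rw [hdeg] at h
  exact h

/-! ### Finiteness of the set of isomorphism classes -/

/-- Both stability conditions fit into one linear inequality, which can be summed over the vertices;
it is automatic for genus at least two. -/
theorem IsStable.three_le (hst : Γ.IsStable) (v : Γ.VA) :
    3 ≤ 2 * Γ.genus v + ∑ i, Γ.valence v i := by
  have := hst v
  omega

/-- Bounds on the size of a stable closed graph in terms of its genus. -/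
theorem IsStable.bounds (hc : Γ.IsClosed) (hst : Γ.IsStable) {g : ℕ}
    (hg : Γ.totalGenus = g) :
    Fintype.card Γ.VA ≤ 2 * g ∧ Fintype.card Γ.VS ≤ 3 * g ∧ ∑ v, Γ.genus v ≤ 3 * g := by
  have h1 : ∑ _v : Γ.VA, 3 ≤ ∑ v, (2 * Γ.genus v + ∑ i, Γ.valence v i) :=
    Finset.sum_le_sum fun v _ => hst.three_le v
  rw [Finset.sum_add_distrib, ← Finset.mul_sum, hc.sum_valence, Finset.sum_const,
    Finset.card_univ, smul_eq_mul] at h1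
  rw [hc.totalGenus_eq] at hg
  -- Substituting `∑ g(v) + |V_s| = g - 1 + |V_a|` into `3|V_a| ≤ 2 ∑ g(v) + 2|V_s|` gives `|V_a| ≤
  -- 2g - 2`, whence `∑ g(v) + |V_s| ≤ 3g - 3`.
  omega

end BipartiteColoredGraph

/-- Combinatorial data of a graph whose vertices and flags are numbered, with all sizes and
genera bounded by `B`. -/
abbrev GraphCode (r B : ℕ) : Type :=
  Σ n : Fin (B + 1) × Fin (B + 1) × Fin (B + 1),
    (Fin n.2.2 → Fin n.1 ⊕ Fin n.2.1) × (Fin n.2.2 → Fin n.2.2) × (Fin n.2.2 → Fin r) ×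
      (Fin n.1 → Fin (B + 1))

/-- The code `c` describes the graph `Γ` for some numbering of its vertices and flags. -/
def GraphCode.Describes {r B : ℕ} (c : GraphCode r B) (Γ : BipartiteColoredGraph r) : Prop :=
  ∃ (eA : Γ.VA ≃ Fin c.1.1) (eS : Γ.VS ≃ Fin c.1.2.1) (eF : Γ.Flag ≃ Fin c.1.2.2),
    (∀ f, c.2.1 (eF f) = Sum.map eA eS (Γ.graph.root f)) ∧
    (∀ f, c.2.2.1 (eF f) = eF (Γ.graph.inv f)) ∧
    (∀ f, c.2.2.2.1 (eF f) = Γ.color f) ∧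
    ∀ v, (c.2.2.2.2 (eA v) : ℕ) = Γ.genus v

/-- Number the first graph, then undo the numbering of the second. A code thus determines its graph
up to isomorphism, which makes the choice of codes in `finite_stableClass` injective. -/
theorem GraphCode.Describes.nonempty_iso {r B : ℕ} {c : GraphCode r B}
    {Γ Δ : BipartiteColoredGraph r} (h : c.Describes Γ) (h' : c.Describes Δ) :
    Nonempty (Iso Γ Δ) := by
  obtain ⟨eA, eS, eF, hr, hi, hcol, hg⟩ := h
  obtain ⟨eA', eS', eF', hr', hi', hcol', hg'⟩ := h'
  refine ⟨⟨eA.trans eA'.symm, eS.trans eS'.symm, eF.trans eF'.symm, ?_, ?_, ?_, ?_⟩⟩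
  · intro f
    have h := hr' (eF'.symm (eF f))
    rw [Equiv.apply_symm_apply, hr] at h
    have h2 := congrArg (Sum.map eA'.symm eS'.symm) h
    simpa [Sum.map_map, Equiv.coe_trans] using h2.symm
  · intro f
    have h := hi' (eF'.symm (eF f))
    rw [Equiv.apply_symm_apply, hi] at h
    simp [h]
  · intro f
    have h := hcol' (eF'.symm (eF f))
    rw [Equiv.apply_symm_apply, hcol] at h
    exact h.symm
  · intro v
    have h := hg' (eA'.symm (eA v))
    rw [Equiv.apply_symm_apply, hg] at h
    exact h.symm

theorem GraphCode.exists_describes {r B : ℕ} (Γ : BipartiteColoredGraph r)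
    (hA : Fintype.card Γ.VA ≤ B) (hS : Fintype.card Γ.VS ≤ B) (hF : Fintype.card Γ.Flag ≤ B)
    (hg : ∀ v, Γ.genus v ≤ B) : ∃ c : GraphCode r B, c.Describes Γ := by
  have eA := Fintype.equivFin Γ.VA
  have eS := Fintype.equivFin Γ.VS
  have eF := Fintype.equivFin Γ.Flag
  refine ⟨⟨(⟨_, Nat.lt_succ_of_le hA⟩, ⟨_, Nat.lt_succ_of_le hS⟩, ⟨_, Nat.lt_succ_of_le hF⟩),
    fun f => Sum.map eA eS (Γ.graph.root (eF.symm f)),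
    fun f => eF (Γ.graph.inv (eF.symm f)),
    fun f => Γ.color (eF.symm f),
    fun v => ⟨Γ.genus (eA.symm v), Nat.lt_succ_of_le (hg _)⟩⟩, eA, eS, eF, ?_, ?_, ?_, ?_⟩ <;>
  simp

theorem finite_stableClass (r g : ℕ) : Finite (StableClass r g) := by
  -- The largest bound needed is for flags: `4|V_s| ≤ 4 * 3g`.
  have key : ∀ q : StableClass r g, ∃ c : GraphCode r (12 * g), c.Describes q.out.1 := by
    intro q
    obtain ⟨-, hc, hst, hg⟩ := q.out.2
    obtain ⟨hA, hS, hG⟩ := IsStable.bounds hc hst hg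
    have hF := hc.card_flag
    refine GraphCode.exists_describes _ (by omega) (by omega) (by omega) fun v => ?_
    have := Finset.single_le_sum (f := q.out.1.genus) (fun _ _ => Nat.zero_le _)
      (Finset.mem_univ v)
    omega
  choose code hcode using key
  refine Finite.of_injective code fun q q' h => Quotient.out_equiv_out.1 ?_
  have h' := hcode q'
  rw [← h] at h'
  exact (hcode q).nonempty_iso h'

theorem StableClass.isWeightedHomogeneous_term {r g : ℕ} (q : StableClass r g) :
    MvPolynomial.IsWeightedHomogeneous (degree r) q.term (1 - (g : ℤ)) := by
  induction q using Quotient.inductionOn with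
  | h Γ =>
    obtain ⟨Γ, -, hc, -, hg⟩ := Γ
    have h := hc.isWeightedHomogeneous_monomial
    rw [hg] at h
    exact (MvPolynomial.weightedHomogeneousSubmodule ℂ (degree r) _).smul_mem _ h

end StableGraph

theorem mainTheorem8 (r g : ℕ) :
    Finite (StableGraph.StableClass r g) ∧
      MvPolynomial.IsWeightedHomogeneous (StableGraph.degree r)
        (StableGraph.stableGraphPolynomial r g) (1 - (g : ℤ)) := by
  refine ⟨StableGraph.finite_stableClass r g, ?_⟩
  -- Homogeneous polynomials of a fixed degree contain zero and are closed under sums, so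
  -- homogeneity passes from the terms to `∑ᶠ`.
  exact finsum_induction
    (fun p => MvPolynomial.IsWeightedHomogeneous (StableGraph.degree r) p (1 - (g : ℤ)))
    (MvPolynomial.isWeightedHomogeneous_zero _ _ _) (fun _ _ hp hq => hp.add hq)
    fun q => q.isWeightedHomogeneous_term
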